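/- Let $n\ge 1$ and $d_L\ge 1$ be integers. Let $L$ be a quantum system with Hilbert space $\mathbb C^{d_L}$ and orthonormal basis $|0\rangle,\dots,|d_L-1\rangle$, and let $P=P_1\cdots P_n$ consist of $n$ subsystems, each with Hilbert space $\mathbb C^{d_L+1}$ and orthonormal basis $|0\rangle,\dots,|d_L\rangle$. For $0\le i<d_L$ put $$|i^{(n)}\rangle=\frac1{\sqrt n}\bigl(|i,d_L,\dots,d_L\rangle+|d_L,i,d_L,\dots,d_L\rangle+\dots+|d_L,\dots,d_L,i\rangle\bigr),\qquad V^{(n)}=\sum_{i=0}^{d_L-1}|i^{(n)}\rangle\langle i|,$$ and let $\mathcal E^{(n)}(X)=V^{(n)}XV^{(n)\dagger}$ be the encoder of the W-state code. Then: (1) $V^{(n)}$ is an isometry, so $\mathcal E^{(n)}$ is a quantum channel (a completely positive trace-preserving map) from $L$ to $P$. (2) The code admits a transversal implementation of the full unitary group $U(d_L)$: there are continuous unitary representations $V_k:U(d_L)\to U(d_L+1)$, $k=1,\dots,n$, such that for all $U\in U(d_L)$ and all operators $X$ on $L$, $$\mathcal E^{(n)}(UXU^\dagger)=\bigl(V_1(U)\otimes\dots\otimes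 V_n(U)\bigr)\,\mathcal E^{(n)}(X)\,\bigl(V_1(U)\otimes\dots\otimes V_n(U)\bigr)^\dagger .$$ (3) Let $S\subseteq\{1,\dots,n\}$ be any set of $N_e$ subsystems, let $P'$ consist of the remaining ones, and let $\mathrm{tr}_S$ be the erasure of the subsystems in $S$ (the partial trace over them). For every real $\varepsilon$, the code can $\varepsilon$-correct this erasure, that is, there is a quantum channel $\mathcal D$ from $P'$ to $L$ with $$F\bigl(\mathcal D\circ\mathrm{tr}_S\circ\mathcal E^{(n)}(|\psi\rangle\langle\psi|),\,|\psi\rangle\langle\psi|\bigr)\ge 1-\varepsilon\quad\text{for all unit vectors }\psi\in\mathbb C^{d_L},$$ where $F(\rho,\sigma)=\bigl(\mathrm{tr}\sqrt{\sqrt\rho\,\sigma\sqrt\rho}\bigr)^2$ is the fidelity, if and only if $$\varepsilon\ \ge\ \frac{N_e}{n}\Bigl(1-\frac1{d_L}\Bigr).$$ -/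

import Mathlib

open scoped Matrix MatrixOrder Matrix.Norms.L2Operator CStarAlgebra

namespace QCode

noncomputable section

/-! Operators on a finite-dimensional Hilbert space with orthonormal basis indexed by `a` are the
complex matrices `Matrix a a ℂ`, with the Loewner order and the operator norm, which make them a
C⋆-algebra. A system of `n` subsystems, each with basis `q`, has basis `Fin n → q`. -/

/-- Quantum channels: completely positive trace-preserving linear maps. -/
structure IsChannel {a b : Type*} [Fintype a] [DecidableEq a] [Fintype b] [DecidableEq b]
    (Φ : Matrix a a ℂ →ₗ[ℂ] Matrix b b ℂ) : Prop where
  completelyPositive : ∃ Ψ : Matrix a a ℂ →CP Matrix b b ℂ, Ψ.toLinearMap = Φ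
  tracePreserving : ∀ X : Matrix a a ℂ, (Φ X).trace = X.trace

/-- The fidelity `F(ρ, σ) = (tr √(√ρ σ √ρ))²` of two states. -/
def fidelity {a : Type*} [Fintype a] [DecidableEq a] (ρ σ : Matrix a a ℂ) : ℝ :=
  (CFC.sqrt (CFC.sqrt ρ * σ * CFC.sqrt ρ)).trace.re ^ 2

/-- The projector `|ψ⟩⟨ψ|`, a pure state when `ψ` is a unit vector. -/
def pureState {a : Type*} (ψ : EuclideanSpace ℂ a) : Matrix a a ℂ :=
  Matrix.vecMulVec (fun i => ψ i) (fun i => star (ψ i))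

/-- The code with encoder `E` is `ε`-correcting under the noise `N`: one recovery channel restores
every pure logical state with fidelity at least `1 - ε`. -/
def IsCorrecting {l p p' : Type*} [Fintype l] [DecidableEq l] [Fintype p'] [DecidableEq p']
    (E : Matrix l l ℂ →ₗ[ℂ] Matrix p p ℂ) (N : Matrix p p ℂ →ₗ[ℂ] Matrix p' p' ℂ) (ε : ℝ) : Prop :=
  ∃ D : Matrix p' p' ℂ →ₗ[ℂ] Matrix l l ℂ, IsChannel D ∧
    ∀ ψ : EuclideanSpace ℂ l, ‖ψ‖ = 1 →
      1 - ε ≤ fidelity (D (N (E (pureState ψ)))) (pureState ψ)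

/-- The tensor product `W₁ ⊗ ⋯ ⊗ Wₙ` of operators on the `n` subsystems. -/
def tensorOp {n : ℕ} {q : Type*} (W : Fin n → Matrix q q ℂ) :
    Matrix (Fin n → q) (Fin n → q) ℂ :=
  Matrix.of fun x y => ∏ k, W k (x k) (y k)

/-- The logical gate `X ↦ U X U†` is implemented in the code `E` by the transversal gate
`W₁ ⊗ ⋯ ⊗ Wₙ`. -/
def ImplementsTransversally {l q : Type*} [Fintype l] [DecidableEq l] [Fintype q] [DecidableEq q]
    {n : ℕ} (E : Matrix l l ℂ →ₗ[ℂ] Matrix (Fin n → q) (Fin n → q) ℂ)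
    (U : Matrix.unitaryGroup l ℂ) (W : Fin n → Matrix.unitaryGroup q ℂ) : Prop :=
  ∀ X : Matrix l l ℂ,
    E ((U : Matrix l l ℂ) * X * (U : Matrix l l ℂ)ᴴ) =
      tensorOp (fun k => (W k : Matrix q q ℂ)) * E X * (tensorOp fun k => (W k : Matrix q q ℂ))ᴴ

/-- The code `E` admits a transversal implementation of the full unitary group of the logical
system: every logical unitary is implemented transversally, and the local unitaries can be taken
from continuous unitary representations of the group, so that `E` is covariant. -/
def IsUnitarilyTransversal {l q : Type*} [Fintype l] [DecidableEq l] [Fintype q] [DecidableEq q]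
    {n : ℕ} (E : Matrix l l ℂ →ₗ[ℂ] Matrix (Fin n → q) (Fin n → q) ℂ) : Prop :=
  ∃ V : Fin n → (Matrix.unitaryGroup l ℂ →* Matrix.unitaryGroup q ℂ),
    (∀ k, Continuous (V k)) ∧ ∀ U, ImplementsTransversally E U (fun k => V k U)

/-- The basis label of all `n` subsystems that is `e` on `S` and `x` off `S`. -/
def mergeLabel {n : ℕ} {q : Type*} (S : Finset (Fin n)) (x : {k // k ∉ S} → q)
    (e : {k // k ∈ S} → q) : Fin n → q :=
  fun k => if h : k ∈ S then e ⟨k, h⟩ else x ⟨k, h⟩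

/-- Erasure of the subsystems in `S`: the partial trace over these subsystems. -/
def erasure {n : ℕ} (q : Type*) [Fintype q] (S : Finset (Fin n)) :
    Matrix (Fin n → q) (Fin n → q) ℂ →ₗ[ℂ]
      Matrix ({k // k ∉ S} → q) ({k // k ∉ S} → q) ℂ where
  toFun X := Matrix.of fun x y => ∑ e : {k // k ∈ S} → q, X (mergeLabel S x e) (mergeLabel S y e)
  map_add' X Y := by
    ext x y
    simp [Finset.sum_add_distrib]
  map_smul' c X := by
    ext x y
    simp [Finset.mul_sum]

/-- The codeword `|i⁽ⁿ⁾⟩ = n^(-1/2) (|i,d,…,d⟩ + |d,i,d,…,d⟩ + ⋯ + |d,…,d,i⟩)`; the subsystems have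
basis `Fin (d + 1)`, with `Fin.castSucc i` for `|i⟩`, `i < d`, and `Fin.last d` for `|d⟩`. -/
def wCodeword (d n : ℕ) (i : Fin d) : (Fin n → Fin (d + 1)) → ℂ :=
  ((Real.sqrt n : ℝ) : ℂ)⁻¹ •
    ∑ k : Fin n, Pi.single (Function.update (fun _ => Fin.last d) k (Fin.castSucc i)) 1

/-- The operator `V⁽ⁿ⁾ = ∑ᵢ |i⁽ⁿ⁾⟩⟨i|`. -/
def wOperator (d n : ℕ) : Matrix (Fin n → Fin (d + 1)) (Fin d) ℂ :=
  ∑ i : Fin d, Matrix.vecMulVec (wCodeword d n i) (Pi.single i 1)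

/-- The encoder `X ↦ V⁽ⁿ⁾ X V⁽ⁿ⁾†` of the W-state code. -/
def wEncoder (d n : ℕ) :
    Matrix (Fin d) (Fin d) ℂ →ₗ[ℂ] Matrix (Fin n → Fin (d + 1)) (Fin n → Fin (d + 1)) ℂ where
  toFun X := wOperator d n * X * (wOperator d n)ᴴ
  map_add' X Y := by rw [Matrix.mul_add, Matrix.add_mul]
  map_smul' c X := by simp

end

end QCode

namespace QCode

noncomputable section

open scoped ComplexOrder

/-! A codeword is one excitation spread evenly over the `n` sites. Distinct positions and levels
give orthogonal basis vectors, whence the isometry; `U ⊕ 1` on every site fixes the vacuum level and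
rotates the excitation wherever it sits, whence covariance.

Erasing `S` acts on the logical system as a flagged erasure channel (`erasure_wEncoder`): with
weight `(n - |S|)/n` the excitation survives and a W-code on the remaining sites is left; with
weight `|S|/n` it is lost, leaving the vacuum, which is orthogonal to that code and independent of
the input. Decoding the smaller code and answering the vacuum with the maximally mixed state gives
fidelity `(n - |S|)/n + |S|/(n d)` on every pure state. Conversely, any recovery sends the vacuum to
one fixed state of trace one, whose overlap with the `d` basis states averages `1/d`, so the worst
basis state does no better. -/

/-! ### Kraus maps are channels. -/

/-- A factorisation `star Z * Z` of the flattened matrix, cut back into blocks, is one of `N`. -/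
theorem cstarMatrix_nonneg_of_comp_posSemidef {k b : Type*} [Fintype k] [Fintype b]
    [DecidableEq k] [DecidableEq b] (N : CStarMatrix k k (Matrix b b ℂ))
    (h : (Matrix.comp k k b b ℂ (CStarMatrix.ofMatrix.symm N)).PosSemidef) : 0 ≤ N := by
  obtain ⟨Z, hZ⟩ := CStarAlgebra.nonneg_iff_eq_star_mul_self.mp h.nonneg
  have : N = star (CStarMatrix.ofMatrix ((Matrix.comp k k b b ℂ).symm Z)) *
      CStarMatrix.ofMatrix ((Matrix.comp k k b b ℂ).symm Z) := by
    ext i j x y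
    have := congrFun (congrFun hZ (i, x)) (j, y)
    simp only [CStarMatrix.mul_apply, CStarMatrix.star_apply, Matrix.sum_apply, Matrix.mul_apply,
      Matrix.star_apply, Matrix.comp_apply, Fintype.sum_prod_type] at this ⊢
    exact this
  rw [this]
  exact star_mul_self_nonneg _

theorem exists_eq_star_mul_self_of_nonneg {A : Type*} [NonUnitalCStarAlgebra A] [PartialOrder A]
    [StarOrderedRing A] {x : A} (h : 0 ≤ x) : ∃ y, x = star y * y :=
  CStarAlgebra.nonneg_iff_eq_star_mul_self.mp h

theorem comp_posSemidef_of_cstarMatrix_nonneg {k a : Type*} [Fintype k] [Fintype a]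
    [DecidableEq k] [DecidableEq a] (M : CStarMatrix k k (Matrix a a ℂ)) (h : 0 ≤ M) :
    (Matrix.comp k k a a ℂ (CStarMatrix.ofMatrix.symm M)).PosSemidef := by
  obtain ⟨B, rfl⟩ := exists_eq_star_mul_self_of_nonneg h
  have : Matrix.comp k k a a ℂ (CStarMatrix.ofMatrix.symm (star B * B)) =
      (Matrix.comp k k a a ℂ (CStarMatrix.ofMatrix.symm B))ᴴ *
        Matrix.comp k k a a ℂ (CStarMatrix.ofMatrix.symm B) := by
    ext ⟨i, x⟩ ⟨j, y⟩
    simp only [Matrix.mul_apply, Matrix.conjTranspose_apply, Matrix.comp_apply,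
      Fintype.sum_prod_type, CStarMatrix.ofMatrix_symm_apply, CStarMatrix.mul_apply,
      CStarMatrix.star_apply, Matrix.sum_apply, Matrix.star_apply]
  rw [this]
  exact Matrix.posSemidef_conjTranspose_mul_self _

/-- The map `X ↦ ∑ K X K†` with Kraus operators `K`. -/
def krausMap {a b ι : Type*} [Fintype a] [Fintype ι] (K : ι → Matrix b a ℂ) :
    Matrix a a ℂ →ₗ[ℂ] Matrix b b ℂ where
  toFun X := ∑ r, K r * X * (K r)ᴴ
  map_add' X Y := by simp [Matrix.mul_add, Matrix.add_mul, Finset.sum_add_distrib]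
  map_smul' c X := by simp [Finset.smul_sum]

theorem krausMap_apply {a b ι : Type*} [Fintype a] [Fintype ι] (K : ι → Matrix b a ℂ)
    (X : Matrix a a ℂ) : krausMap K X = ∑ r, K r * X * (K r)ᴴ := rfl

theorem isChannel_krausMap {a b ι : Type*} [Fintype a] [DecidableEq a] [Fintype b] [DecidableEq b]
    [Fintype ι] (K : ι → Matrix b a ℂ) (hK : ∑ r, (K r)ᴴ * K r = 1) : IsChannel (krausMap K) where
  completelyPositive := by
    refine ⟨⟨krausMap K, fun k M hM => ?_⟩, rfl⟩
    apply cstarMatrix_nonneg_of_comp_posSemidef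
    have hM' := comp_posSemidef_of_cstarMatrix_nonneg M hM
    set R := Matrix.comp _ _ a a ℂ (CStarMatrix.ofMatrix.symm M) with hR
    -- After flattening, the entrywise amplification is again a Kraus map, with operators `1 ⊗ K r`.
    have : Matrix.comp _ _ b b ℂ (CStarMatrix.ofMatrix.symm (M.map (krausMap K))) =
        ∑ r, Matrix.kroneckerMap (· * ·) (1 : Matrix (Fin k) (Fin k) ℂ) (K r) * R *
          (Matrix.kroneckerMap (· * ·) (1 : Matrix (Fin k) (Fin k) ℂ) (K r))ᴴ := by
      ext ⟨i, x⟩ ⟨j, y⟩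
      simp only [hR, Matrix.comp_apply, CStarMatrix.ofMatrix_symm_apply, CStarMatrix.map_apply,
        krausMap_apply, Matrix.sum_apply, Matrix.mul_apply, Matrix.conjTranspose_apply,
        Fintype.sum_prod_type, Matrix.kroneckerMap_apply, Matrix.one_apply]
      simp [ite_mul, Finset.sum_ite_irrel, apply_ite star]
    rw [this]
    exact Matrix.posSemidef_sum _ fun r _ => hM'.mul_mul_conjTranspose_same _
  tracePreserving X := by
    calc (krausMap K X).trace = ((∑ r, (K r)ᴴ * K r) * X).trace := by
          simp only [krausMap_apply, Matrix.trace_sum, Finset.sum_mul]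
          exact Finset.sum_congr rfl fun r _ => by
            rw [Matrix.trace_mul_comm, Matrix.mul_assoc]
      _ = X.trace := by rw [hK, one_mul]

theorem IsChannel.posSemidef {a b : Type*} [Fintype a] [DecidableEq a] [Fintype b] [DecidableEq b]
    {Φ : Matrix a a ℂ →ₗ[ℂ] Matrix b b ℂ} (hΦ : IsChannel Φ) {X : Matrix a a ℂ}
    (hX : X.PosSemidef) : (Φ X).PosSemidef := by
  obtain ⟨Ψ, rfl⟩ := hΦ.completelyPositive
  exact Matrix.nonneg_iff_posSemidef.mp (map_nonneg Ψ hX.nonneg)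

/-! ### Fidelity with a pure state. -/

/-- With `t = ‖v‖²`, the matrix `v v†` squares to `t` times itself, so for `t > 0` its root is `v v†
/ √t`, of trace `√t`. -/
theorem sqrt_vecMulVec_star {a : Type*} [Fintype a] [DecidableEq a] (v : a → ℂ) :
    (CFC.sqrt (Matrix.vecMulVec v (star v))).trace.re ^ 2 = (star v ⬝ᵥ v).re := by
  have h0 : 0 ≤ star v ⬝ᵥ v := dotProduct_star_self_nonneg v
  obtain ⟨t, ht, hv⟩ : ∃ t : ℝ, 0 ≤ t ∧ star v ⬝ᵥ v = (t : ℂ) :=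
    ⟨_, (Complex.nonneg_iff.mp h0).1, Complex.ext rfl (Complex.nonneg_iff.mp h0).2.symm⟩
  have hpos : (Matrix.vecMulVec v (star v)).PosSemidef := Matrix.posSemidef_vecMulVec_self_star v
  rcases ht.eq_or_lt with h | h
  · have : v = 0 := by
      apply dotProduct_star_self_eq_zero.mp
      rw [hv, ← h, Complex.ofReal_zero]
    simp [this]
  · have hs : CFC.sqrt (Matrix.vecMulVec v (star v)) =
        ((Real.sqrt t)⁻¹ : ℝ) • Matrix.vecMulVec v (star v) := by
      apply CFC.sqrt_unique
      · rw [smul_mul_smul_comm, Matrix.vecMulVec_mul_vecMulVec, hv, Matrix.vecMulVec_smul,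
          ← mul_inv, Real.mul_self_sqrt ht, ← Complex.coe_smul, smul_smul]
        simp [h.ne']
      · exact (hpos.smul (inv_nonneg.mpr (Real.sqrt_nonneg t))).nonneg
    rw [hs, Matrix.trace_smul, Matrix.trace_vecMulVec, dotProduct_comm, hv]
    have : (Real.sqrt t)⁻¹ * t = Real.sqrt t := by
      rw [inv_mul_eq_div, Real.div_sqrt]
    simp [this, Real.sq_sqrt ht]

/-- `√ρ |ψ⟩⟨ψ| √ρ` has rank at most one, generated by `√ρ ψ`, whose squared norm is `⟨ψ|ρ|ψ⟩`.
Fidelity thus becomes linear in `ρ`. -/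
theorem fidelity_pureState {a : Type*} [Fintype a] [DecidableEq a] {ρ : Matrix a a ℂ}
    (hρ : ρ.PosSemidef) (ψ : EuclideanSpace ℂ a) :
    fidelity ρ (pureState ψ) = (star (fun i => ψ i) ⬝ᵥ ρ *ᵥ (fun i => ψ i)).re := by
  have hsq : CFC.sqrt ρ * CFC.sqrt ρ = ρ := CFC.sqrt_mul_sqrt_self ρ hρ.nonneg
  have hh : (CFC.sqrt ρ)ᴴ = CFC.sqrt ρ :=
    (Matrix.nonneg_iff_posSemidef.mp (CFC.sqrt_nonneg ρ)).isHermitian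
  set w : a → ℂ := fun i => ψ i
  have hw : pureState ψ = Matrix.vecMulVec w (star w) := rfl
  have hv : CFC.sqrt ρ * pureState ψ * CFC.sqrt ρ =
      Matrix.vecMulVec (CFC.sqrt ρ *ᵥ w) (star (CFC.sqrt ρ *ᵥ w)) := by
    rw [hw, Matrix.mul_vecMulVec, Matrix.vecMulVec_mul, Matrix.star_mulVec, hh]
  rw [fidelity, hv, sqrt_vecMulVec_star, Matrix.star_mulVec, hh, ← Matrix.dotProduct_mulVec,
    Matrix.mulVec_mulVec, hsq]

/-! ### The W-code on an arbitrary finite set of sites. -/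

/-- The label with `i` at site `k` and the vacuum label `d` elsewhere. -/
def excite {κ : Type*} [DecidableEq κ] {d : ℕ} (k : κ) (i : Fin d) : κ → Fin (d + 1) :=
  Function.update (fun _ => Fin.last d) k (Fin.castSucc i)

/-- The label with the vacuum label `d` at every site. -/
def vacuum (κ : Type*) (d : ℕ) : κ → Fin (d + 1) := fun _ => Fin.last d

/-- The W-state isometry on the sites `κ`, without normalization. -/
def wMatrix (κ : Type*) [Fintype κ] [DecidableEq κ] (d : ℕ) :
    Matrix (κ → Fin (d + 1)) (Fin d) ℂ :=
  Matrix.of fun x i => ∑ k, if x = excite k i then 1 else 0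

section
variable {κ : Type*} [DecidableEq κ] {d : ℕ}

theorem excite_eq_iff {k l : κ} {i j : Fin d} : excite k i = excite l j ↔ k = l ∧ i = j := by
  refine ⟨fun h => ?_, fun h => by rw [h.1, h.2]⟩
  have hk := congrFun h k
  by_cases hkl : k = l
  · subst hkl
    simpa [excite] using hk
  · simp [excite, Function.update_of_ne hkl] at hk

theorem vacuum_ne_excite (k : κ) (i : Fin d) : vacuum κ d ≠ excite k i := fun h => by
  have := congrFun h k
  simp [excite, vacuum, (Fin.castSucc_ne_last i).symm] at this

variable [Fintype κ]

theorem wMatrix_apply (x : κ → Fin (d + 1)) (i : Fin d) :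
    wMatrix κ d x i = ∑ k, if x = excite k i then 1 else 0 := rfl

theorem conjTranspose_wMatrix_apply (i : Fin d) (x : κ → Fin (d + 1)) :
    (wMatrix κ d)ᴴ i x = wMatrix κ d x i := by
  simp [wMatrix_apply]

theorem wMatrix_vacuum (i : Fin d) : wMatrix κ d (vacuum κ d) i = 0 := by
  simp [wMatrix_apply, vacuum_ne_excite]

/-- Column `i` is the sum of the basis vectors `excite k i`, and these are distinct for distinct
`(k, i)`. An empty `κ` is allowed, as needed when all or no sites are erased. -/
theorem conjTranspose_wMatrix_mul_wMatrix :
    ((wMatrix κ d)ᴴ * wMatrix κ d : Matrix (Fin d) (Fin d) ℂ) = (Fintype.card κ : ℂ) • 1 := by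
  ext i j
  simp only [Matrix.mul_apply, conjTranspose_wMatrix_apply, wMatrix_apply,
    Finset.sum_mul_sum]
  rw [Finset.sum_comm]
  simp_rw [Finset.sum_comm (s := (Finset.univ : Finset (κ → Fin (d + 1))))]
  simp [excite_eq_iff, ite_and, Matrix.one_apply, Finset.sum_ite_irrel, eq_comm]

end

theorem wOperator_eq (d n : ℕ) :
    wOperator d n = ((Real.sqrt n : ℝ) : ℂ)⁻¹ • wMatrix (Fin n) d := by
  ext x i
  simp only [wOperator, wCodeword, Matrix.sum_apply, Matrix.vecMulVec_apply, Pi.single_apply,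
    Matrix.smul_apply, Pi.smul_apply, Finset.sum_apply, wMatrix_apply, excite, mul_ite, mul_one,
    mul_zero, Finset.sum_ite_eq, Finset.mem_univ, if_true]
  rfl

theorem wOperator_isometry (d n : ℕ) (hn : 0 < n) :
    ((wOperator d n)ᴴ * wOperator d n : Matrix _ _ ℂ) = 1 := by
  have hs : ((Real.sqrt n : ℝ) : ℂ)⁻¹ * ((Real.sqrt n : ℝ) : ℂ)⁻¹ * n = 1 := by
    have h : ((Real.sqrt n : ℝ) : ℂ) * ((Real.sqrt n : ℝ) : ℂ) = n := by
      rw [← Complex.ofReal_mul, Real.mul_self_sqrt (Nat.cast_nonneg n), Complex.ofReal_natCast]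
    have hn' : (n : ℂ) ≠ 0 := Nat.cast_ne_zero.mpr hn.ne'
    rw [← mul_inv, h, inv_mul_cancel₀ hn']
  rw [wOperator_eq, Matrix.conjTranspose_smul, Matrix.smul_mul, Matrix.mul_smul,
    conjTranspose_wMatrix_mul_wMatrix, smul_smul, smul_smul, Fintype.card_fin, star_inv₀,
    Complex.star_def, Complex.conj_ofReal, hs, one_smul]

theorem wEncoder_eq_wMatrix (d n : ℕ) (X : Matrix (Fin d) (Fin d) ℂ) :
    wEncoder d n X = (n : ℂ)⁻¹ • (wMatrix (Fin n) d * X * (wMatrix (Fin n) d)ᴴ :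
      Matrix (Fin n → Fin (d + 1)) (Fin n → Fin (d + 1)) ℂ) := by
  have h : ((Real.sqrt n : ℝ) : ℂ) * ((Real.sqrt n : ℝ) : ℂ) = n := by
    rw [← Complex.ofReal_mul, Real.mul_self_sqrt (Nat.cast_nonneg n), Complex.ofReal_natCast]
  change (wOperator d n * X * (wOperator d n)ᴴ : Matrix _ _ ℂ) = _
  rw [wOperator_eq, Matrix.conjTranspose_smul, Matrix.smul_mul, Matrix.smul_mul, Matrix.mul_smul,
    smul_smul, star_inv₀, Complex.star_def, Complex.conj_ofReal, ← mul_inv, h]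

theorem isChannel_wEncoder (d n : ℕ) (hn : 0 < n) : IsChannel (wEncoder d n) := by
  have : wEncoder d n = krausMap fun _ : Unit => wOperator d n := by
    ext1 X
    simp [krausMap_apply, wEncoder]
  rw [this]
  exact isChannel_krausMap _ (by simpa using wOperator_isometry d n hn)

/-! ### Transversal gates. -/

/-- The block-diagonal matrix `U ⊕ 1`. -/
def extendMatrix {d : ℕ} (U : Matrix (Fin d) (Fin d) ℂ) : Matrix (Fin (d + 1)) (Fin (d + 1)) ℂ :=
  Matrix.of fun x y => Fin.lastCases (motive := fun _ => ℂ)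
    (Fin.lastCases (motive := fun _ => ℂ) 1 (fun _ => 0) y)
    (fun i => Fin.lastCases (motive := fun _ => ℂ) 0 (fun j => U i j) y) x

section
variable {d : ℕ} (U V : Matrix (Fin d) (Fin d) ℂ)

@[simp] theorem extendMatrix_last_last : extendMatrix U (Fin.last d) (Fin.last d) = 1 := by
  simp [extendMatrix]

@[simp] theorem extendMatrix_castSucc_last (i : Fin d) :
    extendMatrix U i.castSucc (Fin.last d) = 0 := by
  simp [extendMatrix]

@[simp] theorem extendMatrix_last_castSucc (j : Fin d) :
    extendMatrix U (Fin.last d) j.castSucc = 0 := by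
  simp [extendMatrix]

@[simp] theorem extendMatrix_castSucc_castSucc (i j : Fin d) :
    extendMatrix U i.castSucc j.castSucc = U i j := by
  simp [extendMatrix]

theorem extendMatrix_one : extendMatrix (1 : Matrix (Fin d) (Fin d) ℂ) = 1 := by
  ext x y
  refine Fin.lastCases ?_ (fun i => ?_) x <;> refine Fin.lastCases ?_ (fun j => ?_) y <;>
    simp [Matrix.one_apply, Fin.castSucc_ne_last, (Fin.castSucc_ne_last _).symm]

theorem extendMatrix_mul : extendMatrix (U * V) = extendMatrix U * extendMatrix V := by
  ext x y
  refine Fin.lastCases ?_ (fun i => ?_) x <;> refine Fin.lastCases ?_ (fun j => ?_) y <;>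
    simp [Matrix.mul_apply, Fin.sum_univ_castSucc]

theorem extendMatrix_star : extendMatrix (star U) = star (extendMatrix U) := by
  ext x y
  refine Fin.lastCases ?_ (fun i => ?_) x <;> refine Fin.lastCases ?_ (fun j => ?_) y <;>
    simp [Matrix.star_apply]

theorem extendMatrix_apply_last (x : Fin (d + 1)) :
    extendMatrix U x (Fin.last d) = if x = Fin.last d then 1 else 0 := by
  refine Fin.lastCases ?_ (fun i => ?_) x <;> simp [Fin.castSucc_ne_last]

theorem extendMatrix_apply_castSucc (x : Fin (d + 1)) (i : Fin d) :
    extendMatrix U x i.castSucc = ∑ j, (if x = j.castSucc then 1 else 0) * U j i := by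
  refine Fin.lastCases ?_ (fun i => ?_) x <;> simp [(Fin.castSucc_ne_last _).symm]

theorem continuous_extendMatrix :
    Continuous (extendMatrix : Matrix (Fin d) (Fin d) ℂ → Matrix (Fin (d + 1)) (Fin (d + 1)) ℂ) := by
  refine continuous_matrix fun x y => ?_
  refine Fin.lastCases ?_ (fun i => ?_) x <;> refine Fin.lastCases ?_ (fun j => ?_) y <;>
    simp only [extendMatrix_last_last, extendMatrix_last_castSucc, extendMatrix_castSucc_last,
      extendMatrix_castSucc_castSucc]
  all_goals fun_prop

/-- The representation `U ↦ U ⊕ 1`. -/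
def extendUnitary (d : ℕ) :
    Matrix.unitaryGroup (Fin d) ℂ →* Matrix.unitaryGroup (Fin (d + 1)) ℂ where
  toFun U := ⟨extendMatrix U, by
    rw [Matrix.mem_unitaryGroup_iff, ← extendMatrix_star, ← extendMatrix_mul,
      Matrix.mem_unitaryGroup_iff.mp U.2, extendMatrix_one]⟩
  map_one' := Subtype.ext extendMatrix_one
  map_mul' U V := Subtype.ext (extendMatrix_mul _ _)

/-- Off site `k` every factor acts on the vacuum level, which it fixes; only the factor `U` at `k`
remains. -/
theorem tensorOp_extendMatrix_apply_excite {n : ℕ} (x : Fin n → Fin (d + 1)) (k : Fin n)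
    (i : Fin d) : tensorOp (fun _ => extendMatrix U) x (excite k i) =
      ∑ j, (if x = excite k j then 1 else 0) * U j i := by
  have hx (j : Fin d) : (if x = excite k j then (1 : ℂ) else 0) =
      (if x k = j.castSucc then 1 else 0) *
        ∏ l ∈ Finset.univ.erase k, if x l = Fin.last d then 1 else 0 := by
    rw [Finset.prod_ite_zero]
    simp [excite, Function.eq_update_iff, ← ite_and, and_comm]
  have hp : ∀ l ∈ Finset.univ.erase k, extendMatrix U (x l) (excite k i l) =
      if x l = Fin.last d then 1 else 0 := fun l hl => by
    rw [excite, Function.update_of_ne (Finset.ne_of_mem_erase hl), extendMatrix_apply_last]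
  simp_rw [tensorOp, Matrix.of_apply, hx]
  rw [← Finset.mul_prod_erase _ _ (Finset.mem_univ k), Finset.prod_congr rfl hp]
  simp only [excite, Function.update_self, extendMatrix_apply_castSucc, Finset.sum_mul]
  exact Finset.sum_congr rfl fun j _ => by ring

/-- This intertwining relation yields covariance of the encoder on conjugating any `X`. -/
theorem tensorOp_extendMatrix_mul_wMatrix (n : ℕ) :
    (tensorOp (fun _ : Fin n => extendMatrix U) * wMatrix (Fin n) d :
      Matrix (Fin n → Fin (d + 1)) (Fin d) ℂ) =
      wMatrix (Fin n) d * U := by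
  ext x i
  simp only [Matrix.mul_apply, wMatrix_apply, Finset.mul_sum, Finset.sum_mul]
  rw [Finset.sum_comm]
  rw [Finset.sum_comm (s := (Finset.univ : Finset (Fin d)))]
  refine Finset.sum_congr rfl fun k _ => ?_
  simp [tensorOp_extendMatrix_apply_excite]

end

theorem isUnitarilyTransversal_wEncoder (d n : ℕ) : IsUnitarilyTransversal (wEncoder d n) := by
  refine ⟨fun _ => extendUnitary d, fun _ => ?_, fun U X => ?_⟩
  · exact (continuous_extendMatrix.comp continuous_subtype_val).subtype_mk _
  · change _ = (tensorOp (fun _ => extendMatrix (U : Matrix (Fin d) (Fin d) ℂ)) * wEncoder d n X *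
      (tensorOp (fun _ => extendMatrix (U : Matrix (Fin d) (Fin d) ℂ)))ᴴ : Matrix _ _ ℂ)
    rw [wEncoder_eq_wMatrix, wEncoder_eq_wMatrix, Matrix.mul_smul, Matrix.smul_mul]
    congr 1
    have h := tensorOp_extendMatrix_mul_wMatrix (U : Matrix (Fin d) (Fin d) ℂ) n
    calc _ = ((wMatrix (Fin n) d * (U : Matrix (Fin d) (Fin d) ℂ) : Matrix _ _ ℂ) * X *
          (wMatrix (Fin n) d * (U : Matrix (Fin d) (Fin d) ℂ) : Matrix _ _ ℂ)ᴴ :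
            Matrix (Fin n → Fin (d + 1)) (Fin n → Fin (d + 1)) ℂ) := by
          simp only [Matrix.conjTranspose_mul, Matrix.mul_assoc]
      _ = _ := by
          rw [← h]
          simp only [Matrix.conjTranspose_mul, Matrix.mul_assoc]

/-! ### The code after erasure. -/

theorem mergeLabel_eq_excite_iff_of_mem {d n : ℕ} {S : Finset (Fin n)}
    (x : {k // k ∉ S} → Fin (d + 1)) (e : {k // k ∈ S} → Fin (d + 1)) (k : {k // k ∈ S})
    (i : Fin d) : mergeLabel S x e = excite k.1 i ↔ x = vacuum _ d ∧ e = excite k i := by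
  obtain ⟨k, hk⟩ := k
  constructor
  · intro h
    refine ⟨funext fun ⟨l, hl⟩ => ?_, funext fun ⟨l, hl⟩ => ?_⟩
    · have hlk : l ≠ k := fun h => hl (h ▸ hk)
      simpa [mergeLabel, hl, excite, hlk, vacuum] using congrFun h l
    · simpa [mergeLabel, hl, excite, Function.update_apply] using congrFun h l
  · rintro ⟨rfl, rfl⟩
    funext l
    by_cases hl : l ∈ S
    · simp [mergeLabel, hl, excite, Function.update_apply]
    · have hlk : l ≠ k := fun h => hl (h ▸ hk)
      simp [mergeLabel, hl, excite, hlk, vacuum]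

theorem mergeLabel_eq_excite_iff_of_notMem {d n : ℕ} {S : Finset (Fin n)}
    (x : {k // k ∉ S} → Fin (d + 1)) (e : {k // k ∈ S} → Fin (d + 1)) (k : {k // k ∉ S})
    (i : Fin d) : mergeLabel S x e = excite k.1 i ↔ e = vacuum _ d ∧ x = excite k i := by
  obtain ⟨k, hk⟩ := k
  constructor
  · intro h
    refine ⟨funext fun ⟨l, hl⟩ => ?_, funext fun ⟨l, hl⟩ => ?_⟩
    · have hlk : l ≠ k := fun h => hk (h ▸ hl)
      simpa [mergeLabel, hl, excite, hlk, vacuum] using congrFun h l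
    · simpa [mergeLabel, hl, excite, Function.update_apply] using congrFun h l
  · rintro ⟨rfl, rfl⟩
    funext l
    by_cases hl : l ∈ S
    · have hlk : l ≠ k := fun h => hk (h ▸ hl)
      simp [mergeLabel, hl, excite, hlk, vacuum]
    · simp [mergeLabel, hl, excite, Function.update_apply]

/-- The excitation sits either off `S` or in `S`, and the other side is then in the vacuum. -/
theorem wMatrix_mergeLabel {d n : ℕ} (S : Finset (Fin n)) (x : {k // k ∉ S} → Fin (d + 1))
    (e : {k // k ∈ S} → Fin (d + 1)) (i : Fin d) :
    wMatrix (Fin n) d (mergeLabel S x e) i =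
      (if e = vacuum _ d then 1 else 0) * wMatrix {k // k ∉ S} d x i +
        (if x = vacuum _ d then 1 else 0) * wMatrix {k // k ∈ S} d e i := by
  simp only [wMatrix_apply, Finset.mul_sum]
  rw [← Fintype.sum_subtype_add_sum_subtype (fun k => k ∈ S)
    (fun k => if mergeLabel S x e = excite k i then (1 : ℂ) else 0), add_comm]
  congr 1
  · refine Finset.sum_congr rfl fun k _ => ?_
    simp only [mergeLabel_eq_excite_iff_of_notMem, ite_and, ite_mul, one_mul, zero_mul]
  · refine Finset.sum_congr (by ext; simp) fun k _ => ?_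
    simp only [mergeLabel_eq_excite_iff_of_mem, ite_and, ite_mul, one_mul, zero_mul]

/-- The two alternatives leave orthogonal states on `S`, so the partial trace kills the cross terms.
The lost branch keeps only the trace of `X`, because the columns on `S` are orthogonal with squared
norm `|S|`. -/
theorem erasure_wEncoder (d n : ℕ) (S : Finset (Fin n)) (X : Matrix (Fin d) (Fin d) ℂ) :
    erasure (Fin (d + 1)) S (wEncoder d n X) = (n : ℂ)⁻¹ •
      ((wMatrix {k // k ∉ S} d * X * (wMatrix {k // k ∉ S} d)ᴴ :
        Matrix ({k // k ∉ S} → Fin (d + 1)) ({k // k ∉ S} → Fin (d + 1)) ℂ) +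
        ((S.card : ℂ) * X.trace) • Matrix.single (vacuum _ d) (vacuum _ d) 1) := by
  rw [wEncoder_eq_wMatrix, map_smul]
  congr 1
  ext x y
  have htr : ∑ e, (wMatrix {k // k ∈ S} d * X * (wMatrix {k // k ∈ S} d)ᴴ :
        Matrix ({k // k ∈ S} → Fin (d + 1)) ({k // k ∈ S} → Fin (d + 1)) ℂ) e e =
      (S.card : ℂ) * X.trace := by
    change Matrix.trace _ = _
    rw [Matrix.trace_mul_comm, ← Matrix.mul_assoc, conjTranspose_wMatrix_mul_wMatrix]
    simp
  set B := wMatrix {k // k ∉ S} d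
  set C := wMatrix {k // k ∈ S} d
  -- For `e` the vacuum the amplitudes `C e` vanish; for any other `e` the surviving branch does.
  have hrow (e : {k // k ∈ S} → Fin (d + 1)) :
      (wMatrix (Fin n) d * X * (wMatrix (Fin n) d)ᴴ :
      Matrix (Fin n → Fin (d + 1)) (Fin n → Fin (d + 1)) ℂ) (mergeLabel S x e) (mergeLabel S y e) =
        (if e = vacuum _ d then (B * X * Bᴴ : Matrix _ _ ℂ) x y else 0) +
          (if x = vacuum _ d then 1 else 0) * (if y = vacuum _ d then 1 else 0) *
            (C * X * Cᴴ : Matrix _ _ ℂ) e e := by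
    simp only [Matrix.mul_apply, conjTranspose_wMatrix_apply,
      wMatrix_mergeLabel, B, C]
    by_cases he : e = vacuum _ d
    · subst he
      simp [wMatrix_vacuum]
    · by_cases hx : x = vacuum _ d <;> by_cases hy : y = vacuum _ d <;> simp [he, hx, hy]
  change ∑ e, (wMatrix (Fin n) d * X * (wMatrix (Fin n) d)ᴴ :
      Matrix (Fin n → Fin (d + 1)) (Fin n → Fin (d + 1)) ℂ) (mergeLabel S x e)
    (mergeLabel S y e) = _
  simp_rw [hrow, Finset.sum_add_distrib, ← Finset.mul_sum, htr]
  simp only [Finset.sum_ite_eq', Finset.mem_univ, if_true, Matrix.add_apply, Matrix.smul_apply,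
    Matrix.single_apply, smul_eq_mul]
  congr 1
  by_cases hx : x = vacuum _ d <;> by_cases hy : y = vacuum _ d <;>
    simp [hx, hy, eq_comm (a := vacuum _ d)]

/-! ### Recovery attaining the bound. -/

theorem sum_single_mul_mul_single {l p : Type*} [Fintype l] [DecidableEq l] [Fintype p]
    [DecidableEq p] (Y : Matrix p p ℂ) :
    ∑ r : l × p, (Matrix.single r.1 r.2 (1 : ℂ) * Y * Matrix.single r.2 r.1 (1 : ℂ) : Matrix l l ℂ) =
      Y.trace • 1 := by
  simp_rw [Matrix.single_mul_mul_single, one_mul, mul_one]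
  ext i j
  simp [Fintype.sum_prod_type, Matrix.sum_apply, Matrix.single_apply, Matrix.trace, Matrix.one_apply,
    ite_and, Finset.sum_ite_irrel]

/-- Undo a partial isometry `A` on its range, and prepare the maximally mixed state off it. -/
theorem exists_recovery_of_partialIsometry {l p : Type*} [Fintype l] [DecidableEq l] [Nonempty l]
    [Fintype p] [DecidableEq p] (A : Matrix p l ℂ) (hA : A * Aᴴ * A = A) :
    ∃ D : Matrix p p ℂ →ₗ[ℂ] Matrix l l ℂ, IsChannel D ∧ ∀ Y, D Y = Aᴴ * Y * A +
      ((Fintype.card l : ℂ)⁻¹ * ((1 - A * Aᴴ) * Y * (1 - A * Aᴴ)).trace) • 1 := by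
  set R : Matrix p p ℂ := 1 - A * Aᴴ with hR
  have hRh : Rᴴ = R := by simp [hR]
  have hRR : R * R = R := by
    rw [hR, sub_mul, one_mul, mul_sub, mul_one, ← Matrix.mul_assoc, hA, sub_self, sub_zero]
  -- In the completeness relation each `r.2` occurs once for every `r.1` in `l`; `s` divides out
  -- this multiplicity.
  set s : ℂ := ((Real.sqrt (Fintype.card l) : ℝ) : ℂ)⁻¹ with hs
  have hss : s * s = (Fintype.card l : ℂ)⁻¹ := by
    rw [hs, ← mul_inv, ← Complex.ofReal_mul, Real.mul_self_sqrt (Nat.cast_nonneg _),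
      Complex.ofReal_natCast]
  have hstar : star s = s := by
    rw [hs, star_inv₀, Complex.star_def, Complex.conj_ofReal]
  let K : Option (l × p) → Matrix l p ℂ := fun r =>
    r.elim Aᴴ fun r => s • (Matrix.single r.1 r.2 (1 : ℂ) * R)
  have hKs (r : l × p) : (K (some r))ᴴ = s • (R * Matrix.single r.2 r.1 (1 : ℂ)) := by
    simp [K, hRh, hstar]
  refine ⟨krausMap K, isChannel_krausMap K ?_, fun Y => ?_⟩
  · have hterm (r : l × p) : (K (some r))ᴴ * K (some r) =
        (Fintype.card l : ℂ)⁻¹ • (R * Matrix.single r.2 r.2 (1 : ℂ) * R) := by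
      rw [hKs]
      change (s • (R * Matrix.single r.2 r.1 (1 : ℂ)) : Matrix p l ℂ) *
        (s • (Matrix.single r.1 r.2 (1 : ℂ) * R) : Matrix l p ℂ) = _
      rw [Matrix.smul_mul, Matrix.mul_smul, smul_smul, hss, Matrix.mul_assoc,
        ← Matrix.mul_assoc (Matrix.single r.2 r.1 (1 : ℂ)), Matrix.single_mul_single_same, mul_one,
        Matrix.mul_assoc]
    have hone : ∑ x : p, Matrix.single x x (1 : ℂ) = 1 := by
      ext i j
      simp [Matrix.sum_apply, Matrix.single_apply, Matrix.one_apply, ite_and]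
    have hl : (Fintype.card l : ℂ) ≠ 0 := Nat.cast_ne_zero.mpr Fintype.card_ne_zero
    rw [Fintype.sum_option]
    simp_rw [hterm]
    rw [← Finset.smul_sum, Fintype.sum_prod_type]
    simp only
    rw [Finset.sum_const, Finset.card_univ, ← Finset.sum_mul, ← Finset.mul_sum, hone, mul_one, hRR,
      ← Nat.cast_smul_eq_nsmul ℂ,
      smul_smul, inv_mul_cancel₀ hl, one_smul]
    simp [K, hR]
  · have hterm (r : l × p) : K (some r) * Y * (K (some r))ᴴ = (Fintype.card l : ℂ)⁻¹ •
        (Matrix.single r.1 r.2 (1 : ℂ) * (R * Y * R) * Matrix.single r.2 r.1 (1 : ℂ)) := by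
      rw [hKs, ← hss]
      simp only [K, Option.elim_some, Matrix.smul_mul, Matrix.mul_smul, smul_smul,
        Matrix.mul_assoc]
    rw [krausMap_apply, Fintype.sum_option]
    simp_rw [hterm]
    rw [← Finset.smul_sum, sum_single_mul_mul_single, smul_smul]
    simp [K]

theorem trace_pureState {a : Type*} [Fintype a] (ψ : EuclideanSpace ℂ a) (hψ : ‖ψ‖ = 1) :
    (pureState ψ).trace = 1 := by
  have h := EuclideanSpace.norm_sq_eq ψ
  rw [hψ, one_pow] at h
  rw [pureState, Matrix.trace_vecMulVec, dotProduct]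
  calc ∑ i, ψ i * star (ψ i) = ((∑ i, ‖ψ i‖ ^ 2 : ℝ) : ℂ) := by
        push_cast
        exact Finset.sum_congr rfl fun i _ => Complex.mul_conj' _
    _ = 1 := by rw [← h, Complex.ofReal_one]

theorem posSemidef_pureState {a : Type*} [Fintype a] (ψ : EuclideanSpace ℂ a) :
    (pureState ψ).PosSemidef :=
  Matrix.posSemidef_vecMulVec_self_star _

theorem exists_recovery_erasure_wEncoder (d n : ℕ) (hd : 0 < d) (S : Finset (Fin n)) :
    ∃ D : Matrix ({k // k ∉ S} → Fin (d + 1)) ({k // k ∉ S} → Fin (d + 1)) ℂ →ₗ[ℂ]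
        Matrix (Fin d) (Fin d) ℂ, IsChannel D ∧ ∀ X,
      D (erasure (Fin (d + 1)) S (wEncoder d n X)) = (n : ℂ)⁻¹ •
        (((n - S.card : ℕ) : ℂ) • X + ((d : ℂ)⁻¹ * (S.card * X.trace)) • 1) := by
  have : Nonempty (Fin d) := ⟨⟨0, hd⟩⟩
  set B := wMatrix {k // k ∉ S} d with hB
  set m : ℕ := n - S.card
  set g := vacuum {k // k ∉ S} d
  have hcard : Fintype.card {k // k ∉ S} = m := by simp [m, Fintype.card_subtype_compl]
  have hBB : (Bᴴ * B : Matrix (Fin d) (Fin d) ℂ) = (m : ℂ) • 1 := by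
    rw [hB, conjTranspose_wMatrix_mul_wMatrix, hcard]
  set c : ℂ := ((Real.sqrt m : ℝ) : ℂ)⁻¹ with hc
  have hcc : c * c = (m : ℂ)⁻¹ := by
    rw [hc, ← mul_inv, ← Complex.ofReal_mul, Real.mul_self_sqrt (Nat.cast_nonneg _),
      Complex.ofReal_natCast]
  have hstar : star c = c := by
    rw [hc, star_inv₀, Complex.star_def, Complex.conj_ofReal]
  -- If every site is erased then `m = 0` and `B = 0`; with `0⁻¹ = 0` also `A = 0`, still a partial
  -- isometry.
  have hm0 : (m : ℂ)⁻¹ • (m : ℂ) • B = B := by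
    by_cases hm : m = 0
    · have : B = 0 := Matrix.conjTranspose_mul_self_eq_zero.mp (by rw [hBB, hm]; simp)
      rw [this]; simp
    · exact inv_smul_smul₀ (Nat.cast_ne_zero.mpr hm) B
  set A := c • B with hA
  have hAA : A * Aᴴ = (m : ℂ)⁻¹ • (B * Bᴴ) := by
    rw [hA, Matrix.conjTranspose_smul, Matrix.smul_mul, Matrix.mul_smul, smul_smul, hstar, hcc]
  have hAB : A * Aᴴ * B = B := by
    rw [hAA, Matrix.smul_mul, Matrix.mul_assoc, hBB, Matrix.mul_smul, Matrix.mul_one, hm0]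
  have hRB : (1 - A * Aᴴ) * B = 0 := by rw [Matrix.sub_mul, Matrix.one_mul, hAB, sub_self]
  set G : Matrix ({k // k ∉ S} → Fin (d + 1)) ({k // k ∉ S} → Fin (d + 1)) ℂ :=
    Matrix.single g g 1 with hG
  -- The vacuum is orthogonal to the range of `B`, so the recovery answers it with the maximally
  -- mixed state.
  have hBG : Bᴴ * G = 0 := by
    ext i x
    by_cases hx : x = g
    · subst hx
      rw [hG, Matrix.mul_single_apply_same, conjTranspose_wMatrix_apply, wMatrix_vacuum]
      simp
    · rw [hG, Matrix.mul_single_apply_of_ne _ _ _ _ _ hx]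
      rfl
  have hRG : (1 - A * Aᴴ) * G = G := by
    rw [Matrix.sub_mul, Matrix.one_mul, hAA, Matrix.smul_mul, Matrix.mul_assoc, hBG]
    simp
  have hGh : Gᴴ = G := by simp [hG]
  have hGR : G * (1 - A * Aᴴ) = G := by
    have := congrArg Matrix.conjTranspose hRG
    simpa [hGh] using this
  obtain ⟨D, hD, hDapply⟩ := exists_recovery_of_partialIsometry A (by
    conv_lhs => rw [hA]
    rw [← hA, Matrix.mul_smul, hAB])
  refine ⟨D, hD, fun X => ?_⟩
  have hDB : D (B * X * Bᴴ) = (m : ℂ) • X := by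
    have h1 : (1 - A * Aᴴ) * (B * X * Bᴴ) * (1 - A * Aᴴ) = 0 := by
      rw [Matrix.mul_assoc B, ← Matrix.mul_assoc _ B, hRB, Matrix.zero_mul, Matrix.zero_mul]
    have h2 : Aᴴ * (B * X * Bᴴ) * A = (c * c) • ((Bᴴ * B) * X * (Bᴴ * B)) := by
      rw [hA, Matrix.conjTranspose_smul, hstar]
      simp only [Matrix.smul_mul, Matrix.mul_smul, smul_smul, Matrix.mul_assoc]
    rw [hDapply, h1, h2, hBB, hcc, Matrix.trace_zero, mul_zero, zero_smul, add_zero,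
      Matrix.smul_mul, Matrix.mul_smul, Matrix.smul_mul, Matrix.mul_one, Matrix.one_mul,
      smul_smul, smul_smul]
    by_cases hm : m = 0
    · simp [hm]
    · rw [inv_mul_cancel₀ (Nat.cast_ne_zero.mpr hm), one_mul]
  have hDG : D G = (d : ℂ)⁻¹ • 1 := by
    have h2 : Aᴴ * G * A = 0 := by
      rw [hA, Matrix.conjTranspose_smul, Matrix.smul_mul, hBG, smul_zero, Matrix.zero_mul]
    rw [hDapply, h2, hRG, hGR, zero_add, Fintype.card_fin, hG, Matrix.trace_single_eq_same,
      mul_one]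
  rw [erasure_wEncoder, map_smul, map_add, map_smul, hDB, hDG, smul_smul, mul_comm]

theorem isCorrecting_wEncoder_of_le (d n : ℕ) (hn : 0 < n) (hd : 0 < d) (S : Finset (Fin n))
    {ε : ℝ} (hε : (S.card : ℝ) / n * (1 - 1 / (d : ℝ)) ≤ ε) :
    IsCorrecting (wEncoder d n) (erasure (Fin (d + 1)) S) ε := by
  obtain ⟨D, hD, hDapply⟩ := exists_recovery_erasure_wEncoder d n hd S
  refine ⟨D, hD, fun ψ hψ => ?_⟩
  have hSn : S.card ≤ n := by simpa using S.card_le_univ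
  have htr := trace_pureState ψ hψ
  have hval : D (erasure (Fin (d + 1)) S (wEncoder d n (pureState ψ))) =
      ((((n - S.card : ℕ) : ℝ) / n : ℝ) • pureState ψ +
        (((S.card : ℝ) / n / d : ℝ) • (1 : Matrix (Fin d) (Fin d) ℂ))) := by
    rw [hDapply, htr, smul_add, smul_smul, smul_smul, ← Complex.coe_smul, ← Complex.coe_smul]
    push_cast
    congr 2 <;> ring
  have hpos : (D (erasure (Fin (d + 1)) S (wEncoder d n (pureState ψ)))).PosSemidef := by
    rw [hval]
    exact ((posSemidef_pureState ψ).smul (by positivity)).add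
      (Matrix.PosSemidef.one.smul (by positivity))
  rw [fidelity_pureState hpos, hval]
  have hdot : star (fun i => ψ i) ⬝ᵥ (fun i => ψ i) = (1 : ℂ) := by
    rw [pureState, Matrix.trace_vecMulVec, dotProduct_comm] at htr
    exact htr
  have hψψ : star (fun i => ψ i) ⬝ᵥ (pureState ψ *ᵥ fun i => ψ i) = (1 : ℂ) := by
    change _ ⬝ᵥ (Matrix.vecMulVec (fun i => ψ i) (star fun i => ψ i) *ᵥ fun i => ψ i) = _
    rw [Matrix.vecMulVec_mulVec, hdot]
    simpa using hdot
  rw [Matrix.add_mulVec, Matrix.smul_mulVec, Matrix.smul_mulVec, Matrix.one_mulVec, dotProduct_add,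
    dotProduct_smul, dotProduct_smul, hdot, hψψ]
  have hn' : (n : ℝ) ≠ 0 := Nat.cast_ne_zero.mpr hn.ne'
  have hre : ((((n - S.card : ℕ) : ℝ) / n : ℝ) • (1 : ℂ) +
      (((S.card : ℝ) / n / d : ℝ) • (1 : ℂ))).re =
      1 - (S.card : ℝ) / n * (1 - 1 / (d : ℝ)) := by
    rw [Nat.cast_sub hSn]
    simp
    field_simp
    ring
  rw [hre]
  linarith

/-! ### Optimality. -/

theorem le_of_isCorrecting_wEncoder (d n : ℕ) (hn : 0 < n) (hd : 0 < d) (S : Finset (Fin n))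
    {ε : ℝ} (h : IsCorrecting (wEncoder d n) (erasure (Fin (d + 1)) S) ε) :
    (S.card : ℝ) / n * (1 - 1 / (d : ℝ)) ≤ ε := by
  obtain ⟨D, hD, hF⟩ := h
  have hSn : S.card ≤ n := by simpa using S.card_le_univ
  set B := wMatrix {k // k ∉ S} d with hB
  set G : Matrix ({k // k ∉ S} → Fin (d + 1)) ({k // k ∉ S} → Fin (d + 1)) ℂ :=
    Matrix.single (vacuum _ d) (vacuum _ d) 1 with hG
  have hGpos : G.PosSemidef := by
    rw [hG, Matrix.single_eq_single_vecMulVec_single]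
    simpa using Matrix.posSemidef_vecMulVec_self_star
      (Pi.single (vacuum {k // k ∉ S} d) (1 : ℂ))
  have hGtr : (D G).trace = 1 := by
    rw [hD.tracePreserving, hG, Matrix.trace_single_eq_same]
  obtain ⟨t, ht⟩ : ∃ t : Fin d → ℝ, ∀ i, t i = (D G i i).re := ⟨_, fun _ => rfl⟩
  -- Test on the basis state `i`: the surviving branch is credited with its full weight, a diagonal
  -- entry of a positive matrix being at most the trace.
  have key (i : Fin d) : (n : ℝ) * (1 - ε) ≤ (n - S.card : ℝ) + S.card * t i := by
    set ψ : EuclideanSpace ℂ (Fin d) := EuclideanSpace.single i 1 with hψ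
    have hnorm : ‖ψ‖ = 1 := by simp [hψ]
    have hX := posSemidef_pureState ψ
    have htr := trace_pureState ψ hnorm
    set Y := D (B * pureState ψ * Bᴴ) with hY
    have hYpos : Y.PosSemidef := hD.posSemidef (hX.mul_mul_conjTranspose_same B)
    have hYtr : Y.trace = ((n - S.card : ℝ) : ℂ) := by
      rw [hY, hD.tracePreserving, Matrix.trace_mul_comm, ← Matrix.mul_assoc,
        conjTranspose_wMatrix_mul_wMatrix, Matrix.smul_mul, Matrix.one_mul, Matrix.trace_smul, htr]
      simp [Fintype.card_subtype_compl, Nat.cast_sub hSn]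
    have hYle : (Y i i).re ≤ (n - S.card : ℝ) := by
      have h1 : (Y.trace).re = ∑ j, (Y j j).re := by simp [Matrix.trace]
      rw [hYtr, Complex.ofReal_re] at h1
      rw [h1]
      exact Finset.single_le_sum (f := fun j => (Y j j).re)
        (fun j _ => (Complex.nonneg_iff.mp hYpos.diag_nonneg).1) (Finset.mem_univ i)
    have hval : D (erasure (Fin (d + 1)) S (wEncoder d n (pureState ψ))) =
        ((n : ℝ)⁻¹ : ℝ) • (Y + (S.card : ℝ) • D G) := by
      rw [erasure_wEncoder, map_smul, map_add, map_smul, htr, mul_one, ← Complex.coe_smul,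
        ← Complex.coe_smul]
      push_cast
      rfl
    have hpos : (D (erasure (Fin (d + 1)) S (wEncoder d n (pureState ψ)))).PosSemidef := by
      rw [hval]
      exact (hYpos.add ((hD.posSemidef hGpos).smul (by positivity))).smul (by positivity)
    have hf := hF ψ hnorm
    rw [fidelity_pureState hpos] at hf
    have hentry (M : Matrix (Fin d) (Fin d) ℂ) :
        star (fun j => ψ j) ⬝ᵥ (M *ᵥ fun j => ψ j) = M i i := by
      have : (fun j => ψ j) = Pi.single i 1 := by
        funext j
        simp [hψ, Pi.single_apply]
      rw [this, ← Pi.single_star]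
      simp
    rw [hentry, hval] at hf
    have hn' : (0 : ℝ) < n := Nat.cast_pos.mpr hn
    have hre : ((((n : ℝ)⁻¹ : ℝ) • (Y + (S.card : ℝ) • D G)) i i).re =
        (n : ℝ)⁻¹ * ((Y i i).re + S.card * t i) := by
      simp [mul_add, ht]
    rw [hre, ← div_eq_inv_mul, le_div_iff₀ hn'] at hf
    linarith
  -- Summing over the basis removes the dependence on `D`, as the `t i` sum to the trace of `D G`.
  have hsum := Finset.sum_le_sum fun i (_ : i ∈ (Finset.univ : Finset (Fin d))) => key i
  have hGre : ∑ i, t i = 1 := by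
    have := congrArg Complex.re hGtr
    simpa [Matrix.trace, ht] using this
  simp only [Finset.sum_add_distrib, ← Finset.mul_sum, hGre, Finset.sum_const,
    Finset.card_univ, Fintype.card_fin, nsmul_eq_mul, mul_one] at hsum
  have hn' : (0 : ℝ) < n := Nat.cast_pos.mpr hn
  have hd' : (0 : ℝ) < d := Nat.cast_pos.mpr hd
  have : (S.card : ℝ) / n * (1 - 1 / (d : ℝ)) = (S.card * (d - 1)) / (n * d) := by
    field_simp
  rw [this, div_le_iff₀ (by positivity)]
  linarith

end

end QCode

theorem corollary2 (n d : ℕ) (hn : 0 < n) (hd : 0 < d) :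
    (QCode.wOperator d n)ᴴ * QCode.wOperator d n = 1 ∧
    QCode.IsChannel (QCode.wEncoder d n) ∧
    QCode.IsUnitarilyTransversal (QCode.wEncoder d n) ∧
    ∀ (Ne : ℕ) (S : Finset (Fin n)), S.card = Ne → ∀ ε : ℝ,
      (QCode.IsCorrecting (QCode.wEncoder d n) (QCode.erasure (Fin (d + 1)) S) ε ↔
        ε ≥ (Ne : ℝ) / n * (1 - 1 / (d : ℝ))) := by
  refine ⟨QCode.wOperator_isometry d n hn, QCode.isChannel_wEncoder d n hn,
    QCode.isUnitarilyTransversal_wEncoder d n, ?_⟩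
  rintro _ S rfl ε
  exact ⟨QCode.le_of_isCorrecting_wEncoder d n hn hd S,
    QCode.isCorrecting_wEncoder_of_le d n hn hd S⟩
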